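/- Let $A$ be a real $m\times n$ matrix with $\operatorname{rank}(A)=n$ and Moore–Penrose inverse $A^{\dagger}$. Write $\|\cdot\|_2$ for the Euclidean vector norm and the spectral matrix norm, $\|\cdot\|_F$ for the Frobenius norm, $\kappa_2(A)=\|A\|_2\|A^{\dagger}\|_2$, and $\operatorname{sr}(A)=\|A\|_F^2/\|A\|_2^2$. If the columns of the $m\times n$ matrix $Q$ form an orthonormal basis of the column space of $A$, the leverage scores of $A$ are $\ell_j=\|e_j^TQ\|_2^2$, $1\le j\le m$ (they do not depend on the choice of $Q$). For a real $m\times n$ matrix $\Delta A$ put $$\epsilon_F^{\perp}=\frac{\|(I_m-AA^{\dagger})\Delta A\|_F}{\|A\|_F},\qquad \epsilon_j^{\perp}=\frac{\|e_j^T(I_m-AA^{\dagger})\Delta A\|_2}{\|e_j^TA\|_2}.$$ **Theorem (Projected perturbations).** There is a constant $C$, depending only on $A$, such that for every real $m\times n$ matrix $\Delta A$ with $\|\Delta A\|_2\|A^{\dagger}\|_2\le \tfrac12$ the following holds. The matrix $A+\Delta A$ has rank $n$, and if $A+\Delta A=\tilde Q\tilde R$ is any thin QR decomposition ($\tilde Q$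 is $m\times n$ with orthonormal columns, $\tilde R$ is $n\times n$ upper triangular), then the columns of $\tilde Q$ form an orthonormal basis of the column space of $A+\Delta A$, and the leverage scores $\tilde\ell_j=\|e_j^T\tilde Q\|_2^2$ of $A+\Delta A$ computed from it satisfy, for every $1\le j\le m$ with $\ell_j>0$, $$\frac{|\tilde\ell_j-\ell_j|}{\ell_j}\le 4\left(\epsilon_j^{\perp}+\sqrt2\,\operatorname{sr}(A)^{1/2}\,\epsilon_F^{\perp}\right)\kappa_2(A)+C\,(\epsilon_F^{\perp})^2 .$$ -/

import Mathlib

namespace LeverageScores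

section Norms

open scoped Matrix.Norms.L2Operator

/-- The matrix two-norm (spectral norm): the operator norm for Euclidean vector norms. -/
noncomputable def twoNorm {m n : ℕ} (A : Matrix (Fin m) (Fin n) ℝ) : ℝ := ‖A‖

end Norms

/-- The Frobenius norm. -/
noncomputable def frobNorm {m n : ℕ} (A : Matrix (Fin m) (Fin n) ℝ) : ℝ :=
  Real.sqrt (∑ i, ∑ k, A i k ^ 2)

/-- The Euclidean norm of the `j`-th row of `A`. -/
noncomputable def rowNorm {m n : ℕ} (A : Matrix (Fin m) (Fin n) ℝ) (j : Fin m) : ℝ :=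
  Real.sqrt (∑ k, A j k ^ 2)

/-- The four Penrose equations: `X` is the Moore-Penrose inverse of the real matrix `A`. -/
structure IsMoorePenrose {m n : ℕ} (A : Matrix (Fin m) (Fin n) ℝ)
    (X : Matrix (Fin n) (Fin m) ℝ) : Prop where
  mul_mul_left : A * X * A = A
  mul_mul_right : X * A * X = X
  symm_left : (A * X).transpose = A * X
  symm_right : (X * A).transpose = X * A

theorem IsMoorePenrose.unique {m n : ℕ} {A : Matrix (Fin m) (Fin n) ℝ}
    {X Y : Matrix (Fin n) (Fin m) ℝ} (hX : IsMoorePenrose A X) (hY : IsMoorePenrose A Y) :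
    X = Y := by
  have h1 : A * X = A * Y := by
    calc A * X = (A * X).transpose := hX.symm_left.symm
      _ = ((A * Y) * (A * X)).transpose := by rw [← Matrix.mul_assoc, hY.mul_mul_left]
      _ = (A * X) * (A * Y) := by rw [Matrix.transpose_mul, hX.symm_left, hY.symm_left]
      _ = A * Y := by rw [← Matrix.mul_assoc, hX.mul_mul_left]
  have h2 : X * A = Y * A := by
    calc X * A = (X * A).transpose := hX.symm_right.symm
      _ = ((X * A) * (Y * A)).transpose := by
          rw [Matrix.mul_assoc, ← Matrix.mul_assoc A, hY.mul_mul_left]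
      _ = (Y * A) * (X * A) := by rw [Matrix.transpose_mul, hX.symm_right, hY.symm_right]
      _ = Y * A := by rw [Matrix.mul_assoc, ← Matrix.mul_assoc A, hX.mul_mul_left]
  calc X = X * A * X := hX.mul_mul_right.symm
    _ = Y * A * Y := by rw [h2, Matrix.mul_assoc, h1, ← Matrix.mul_assoc]
    _ = Y := hY.mul_mul_right

open Classical in
/-- The Moore-Penrose inverse of `A`. -/
noncomputable def pinv {m n : ℕ} (A : Matrix (Fin m) (Fin n) ℝ) : Matrix (Fin n) (Fin m) ℝ :=
  if h : ∃ X, IsMoorePenrose A X then h.choose else 0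

theorem isMoorePenrose_of_rank_eq {m n : ℕ} {A : Matrix (Fin m) (Fin n) ℝ} (hA : A.rank = n) :
    IsMoorePenrose A ((A.transpose * A)⁻¹ * A.transpose) := by
  have hu : IsUnit (A.transpose * A) := by
    have hr : (A.transpose * A).rank = n := by rw [Matrix.rank_transpose_mul_self, hA]
    have hsurj : Function.Surjective (A.transpose * A).mulVecLin := by
      rw [← LinearMap.range_eq_top]
      apply Submodule.eq_top_of_finrank_eq
      rw [Module.finrank_fin_fun]
      exact hr
    exact Matrix.mulVec_surjective_iff_isUnit.1 hsurj
  have hd : IsUnit (A.transpose * A).det := (Matrix.isUnit_iff_isUnit_det _).1 hu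
  have h1 : (A.transpose * A)⁻¹ * A.transpose * A = 1 := by
    rw [Matrix.mul_assoc, Matrix.nonsing_inv_mul _ hd]
  refine ⟨?_, ?_, ?_, ?_⟩
  · rw [Matrix.mul_assoc, h1, Matrix.mul_one]
  · rw [h1, Matrix.one_mul]
  · simp [Matrix.transpose_mul, Matrix.transpose_nonsing_inv, Matrix.mul_assoc]
  · rw [h1, Matrix.transpose_one]

/-- Every real matrix of full column rank has a Moore-Penrose inverse, and `pinv` is it. -/
theorem isMoorePenrose_pinv {m n : ℕ} {A : Matrix (Fin m) (Fin n) ℝ} (hA : A.rank = n) :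
    IsMoorePenrose A (pinv A) := by
  have h : ∃ X, IsMoorePenrose A X := ⟨_, isMoorePenrose_of_rank_eq hA⟩
  rw [pinv, dif_pos h]
  exact h.choose_spec

/-- The condition number with respect to left inversion, `κ₂(A) = ‖A‖₂ ‖A†‖₂`. -/
noncomputable def cond2 {m n : ℕ} (A : Matrix (Fin m) (Fin n) ℝ) : ℝ :=
  twoNorm A * twoNorm (pinv A)

/-- The stable rank `sr(A) = ‖A‖_F² / ‖A‖₂²`. -/
noncomputable def stableRank {m n : ℕ} (A : Matrix (Fin m) (Fin n) ℝ) : ℝ :=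
  frobNorm A ^ 2 / twoNorm A ^ 2

/-- The projected perturbation `(I - A A†) ΔA`. -/
noncomputable def projPert {m n : ℕ} (A ΔA : Matrix (Fin m) (Fin n) ℝ) :
    Matrix (Fin m) (Fin n) ℝ :=
  (1 - A * pinv A) * ΔA

/-- `ε_F^⊥ = ‖(I - A A†) ΔA‖_F / ‖A‖_F`. -/
noncomputable def epsPerpF {m n : ℕ} (A ΔA : Matrix (Fin m) (Fin n) ℝ) : ℝ :=
  frobNorm (projPert A ΔA) / frobNorm A

/-- `ε_j^⊥ = ‖e_jᵀ (I - A A†) ΔA‖₂ / ‖e_jᵀ A‖₂`. -/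
noncomputable def epsPerpRow {m n : ℕ} (A ΔA : Matrix (Fin m) (Fin n) ℝ) (j : Fin m) : ℝ :=
  rowNorm (projPert A ΔA) j / rowNorm A j

/-- The columns of `Q` form an orthonormal basis of the column space of `A`. -/
structure IsOrthonormalRangeBasis {m n : ℕ} (A Q : Matrix (Fin m) (Fin n) ℝ) : Prop where
  orthonormal : Q.transpose * Q = 1
  range_eq : LinearMap.range Q.mulVecLin = LinearMap.range A.mulVecLin

/-- `B = Q R` is a thin QR decomposition: `Q` has orthonormal columns and the square matrix `R`
is upper triangular. -/
structure IsThinQR {m n : ℕ} (B Q : Matrix (Fin m) (Fin n) ℝ) (R : Matrix (Fin n) (Fin n) ℝ) :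
    Prop where
  eq_mul : B = Q * R
  orthonormal : Q.transpose * Q = 1
  upper : ∀ i k, k < i → R i k = 0

end LeverageScores

namespace LeverageScores

/-! ### Spectral, Frobenius and row norms. -/

section Norms

open scoped Matrix.Norms.L2Operator

/-! Only the part of `ΔA` orthogonal to the range of `A` moves the column space: with `M = 1 + A†ΔA`
and `E = (I - AA†)ΔA` one has `A + ΔA = AM + E`, and `M` is invertible with inverse of norm at most
2. Multiplying on the right by `W = M⁻¹A†Q` gives `Q + F` with `F = EW` and `QᵀF = 0`. Hence `Q'T =
Q + F` for a square `T` with `TᵀT = 1 + FᵀF`, so `T` is an isometry up to second order in `F`, and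
row `j` of `Q'` differs in norm from row `j` of `Q` by about that of `F` (`abs_rowNorm_sq_sub_le`).
The linear term becomes relative through `IsOrthonormalRangeBasis.rowNorm_le`; the quadratic ones go
into `C`. -/

theorem twoNorm_nonneg {m n : ℕ} (A : Matrix (Fin m) (Fin n) ℝ) : 0 ≤ twoNorm A :=
  norm_nonneg A

theorem twoNorm_add_le {m n : ℕ} (A B : Matrix (Fin m) (Fin n) ℝ) :
    twoNorm (A + B) ≤ twoNorm A + twoNorm B :=
  norm_add_le A B

theorem twoNorm_neg {m n : ℕ} (A : Matrix (Fin m) (Fin n) ℝ) : twoNorm (-A) = twoNorm A :=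
  norm_neg A

theorem twoNorm_mul_le {m n p : ℕ} (A : Matrix (Fin m) (Fin n) ℝ)
    (B : Matrix (Fin n) (Fin p) ℝ) : twoNorm (A * B) ≤ twoNorm A * twoNorm B :=
  Matrix.l2_opNorm_mul A B

theorem twoNorm_transpose {m n : ℕ} (A : Matrix (Fin m) (Fin n) ℝ) :
    twoNorm A.transpose = twoNorm A := by
  rw [← Matrix.conjTranspose_eq_transpose_of_trivial]
  exact Matrix.l2_opNorm_conjTranspose A

theorem twoNorm_transpose_mul_self {m n : ℕ} (A : Matrix (Fin m) (Fin n) ℝ) :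
    twoNorm (A.transpose * A) = twoNorm A ^ 2 := by
  rw [← Matrix.conjTranspose_eq_transpose_of_trivial, sq]
  exact Matrix.l2_opNorm_conjTranspose_mul_self A

theorem norm_mulVec_le_twoNorm {m n : ℕ} (A : Matrix (Fin m) (Fin n) ℝ) (v : Fin n → ℝ) :
    ‖WithLp.toLp 2 (A.mulVec v)‖ ≤ twoNorm A * ‖WithLp.toLp 2 v‖ :=
  Matrix.l2_opNorm_mulVec A (WithLp.toLp 2 v)

theorem twoNorm_le_of_forall {m n : ℕ} {A : Matrix (Fin m) (Fin n) ℝ} {c : ℝ} (hc : 0 ≤ c)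
    (h : ∀ v : Fin n → ℝ, ‖WithLp.toLp 2 (A.mulVec v)‖ ≤ c * ‖WithLp.toLp 2 v‖) :
    twoNorm A ≤ c := by
  unfold twoNorm
  rw [Matrix.l2_opNorm_def]
  exact ContinuousLinearMap.opNorm_le_bound _ hc fun v => h v.ofLp

theorem isUnit_one_add_of_twoNorm_lt_one {n : ℕ} {X : Matrix (Fin n) (Fin n) ℝ}
    (hX : twoNorm X < 1) : IsUnit (1 + X) := by
  have h := isUnit_one_sub_of_norm_lt_one (x := -X) (by rw [norm_neg]; exact hX)
  rwa [sub_neg_eq_add] at h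

end Norms

theorem twoNorm_one_le {n : ℕ} : twoNorm (1 : Matrix (Fin n) (Fin n) ℝ) ≤ 1 :=
  twoNorm_le_of_forall zero_le_one fun v => by rw [Matrix.one_mulVec, one_mul]

theorem norm_toLp_sq {n : ℕ} (v : Fin n → ℝ) : ‖WithLp.toLp 2 v‖ ^ 2 = v ⬝ᵥ v := by
  rw [EuclideanSpace.real_norm_sq_eq]
  exact Finset.sum_congr rfl fun i _ => sq (v i)

theorem rowNorm_eq_norm {m n : ℕ} (A : Matrix (Fin m) (Fin n) ℝ) (j : Fin m) :
    rowNorm A j = ‖WithLp.toLp 2 (A j)‖ := by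
  rw [rowNorm, EuclideanSpace.norm_eq]
  simp

theorem rowNorm_nonneg {m n : ℕ} (A : Matrix (Fin m) (Fin n) ℝ) (j : Fin m) :
    0 ≤ rowNorm A j :=
  Real.sqrt_nonneg _

theorem rowNorm_add_le {m n : ℕ} (A B : Matrix (Fin m) (Fin n) ℝ) (j : Fin m) :
    rowNorm (A + B) j ≤ rowNorm A j + rowNorm B j := by
  simp only [rowNorm_eq_norm]
  exact norm_add_le (WithLp.toLp 2 (A j)) (WithLp.toLp 2 (B j))

theorem rowNorm_le_add {m n : ℕ} (A B : Matrix (Fin m) (Fin n) ℝ) (j : Fin m) :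
    rowNorm A j ≤ rowNorm (A + B) j + rowNorm B j := by
  simp only [rowNorm_eq_norm]
  have h := norm_sub_le (WithLp.toLp 2 (A j) + WithLp.toLp 2 (B j)) (WithLp.toLp 2 (B j))
  rwa [add_sub_cancel_right] at h

theorem rowNorm_mul_le {m n p : ℕ} (A : Matrix (Fin m) (Fin n) ℝ)
    (B : Matrix (Fin n) (Fin p) ℝ) (j : Fin m) :
    rowNorm (A * B) j ≤ rowNorm A j * twoNorm B := by
  simp only [rowNorm_eq_norm]
  have h := norm_mulVec_le_twoNorm B.transpose (A j)
  rw [Matrix.mulVec_transpose, twoNorm_transpose, mul_comm] at h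
  exact h

theorem rowNorm_sq {m n : ℕ} (A : Matrix (Fin m) (Fin n) ℝ) (j : Fin m) :
    rowNorm A j ^ 2 = (A * A.transpose) j j := by
  rw [rowNorm_eq_norm, norm_toLp_sq]
  rfl

theorem frobNorm_nonneg {m n : ℕ} (A : Matrix (Fin m) (Fin n) ℝ) : 0 ≤ frobNorm A :=
  Real.sqrt_nonneg _

theorem frobNorm_sq {m n : ℕ} (A : Matrix (Fin m) (Fin n) ℝ) :
    frobNorm A ^ 2 = ∑ j, rowNorm A j ^ 2 := by
  rw [frobNorm, Real.sq_sqrt (by positivity)]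
  refine Finset.sum_congr rfl fun j _ => ?_
  rw [rowNorm, Real.sq_sqrt (by positivity)]

theorem rowNorm_le_frobNorm {m n : ℕ} (A : Matrix (Fin m) (Fin n) ℝ) (j : Fin m) :
    rowNorm A j ≤ frobNorm A := by
  refine abs_le_of_sq_le_sq' ?_ (frobNorm_nonneg A) |>.2
  rw [frobNorm_sq]
  exact Finset.single_le_sum (f := fun i => rowNorm A i ^ 2) (fun i _ => sq_nonneg _)
    (Finset.mem_univ j)

theorem twoNorm_le_frobNorm {m n : ℕ} (A : Matrix (Fin m) (Fin n) ℝ) :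
    twoNorm A ≤ frobNorm A := by
  refine twoNorm_le_of_forall (frobNorm_nonneg A) fun v => ?_
  refine abs_le_of_sq_le_sq' ?_ (mul_nonneg (frobNorm_nonneg A) (norm_nonneg _)) |>.2
  rw [mul_pow, frobNorm_sq, Finset.sum_mul, EuclideanSpace.real_norm_sq_eq]
  refine Finset.sum_le_sum fun j _ => ?_
  rw [← mul_pow, rowNorm_eq_norm]
  have h := abs_real_inner_le_norm (WithLp.toLp 2 v) (WithLp.toLp 2 (A j))
  rw [EuclideanSpace.inner_toLp_toLp] at h
  rw [← sq_abs, mul_comm]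
  exact pow_le_pow_left₀ (abs_nonneg _) (by simpa [Matrix.mulVec] using h) 2

/-- Evaluating the quadratic form at `v` gives `‖Sv‖² + ‖Hv‖² = ‖v‖²`. -/
theorem twoNorm_le_one_of_add_eq_one {m n p : ℕ} {S : Matrix (Fin m) (Fin n) ℝ}
    {H : Matrix (Fin p) (Fin n) ℝ} (h : S.transpose * S + H.transpose * H = 1) :
    twoNorm S ≤ 1 := by
  refine twoNorm_le_of_forall zero_le_one fun v => ?_
  rw [one_mul]
  refine abs_le_of_sq_le_sq' ?_ (norm_nonneg _) |>.2
  have key : ∀ {r : ℕ} (X : Matrix (Fin r) (Fin n) ℝ),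
      v ⬝ᵥ (X.transpose * X).mulVec v = ‖WithLp.toLp 2 (X.mulVec v)‖ ^ 2 := fun X => by
    rw [norm_toLp_sq, ← Matrix.mulVec_mulVec, Matrix.dotProduct_mulVec, Matrix.vecMul_transpose]
  have hv : v ⬝ᵥ (S.transpose * S + H.transpose * H).mulVec v = ‖WithLp.toLp 2 v‖ ^ 2 := by
    rw [h, Matrix.one_mulVec, norm_toLp_sq]
  rw [Matrix.add_mulVec, dotProduct_add, key, key] at hv
  linarith [sq_nonneg ‖WithLp.toLp 2 (H.mulVec v)‖]

theorem twoNorm_le_one_of_orthonormal {m n : ℕ} {Q : Matrix (Fin m) (Fin n) ℝ}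
    (hQ : Q.transpose * Q = 1) : twoNorm Q ≤ 1 :=
  twoNorm_le_one_of_add_eq_one (H := (0 : Matrix (Fin n) (Fin n) ℝ)) (by simp [hQ])

/-- The inverse of `1 + X` has two-norm at most `2` when `X` has two-norm at most `1 / 2`. -/
theorem twoNorm_inv_one_add_le {n : ℕ} {X : Matrix (Fin n) (Fin n) ℝ}
    (hX : twoNorm X ≤ 1 / 2) : twoNorm (1 + X)⁻¹ ≤ 2 := by
  have hu := (Matrix.isUnit_iff_isUnit_det _).1
    (isUnit_one_add_of_twoNorm_lt_one (X := X) (by linarith))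
  -- Taking norms, `y = ‖(1 + X)⁻¹‖` satisfies `y ≤ 1 + y / 2`.
  have h1 : (1 + X)⁻¹ = 1 + -(X * (1 + X)⁻¹) := by
    have := Matrix.mul_nonsing_inv _ hu
    rw [Matrix.add_mul, Matrix.one_mul] at this
    rw [← sub_eq_add_neg]
    exact eq_sub_of_add_eq this
  have h2 := twoNorm_add_le 1 (-(X * (1 + X)⁻¹))
  rw [← h1, twoNorm_neg] at h2
  have h3 := twoNorm_mul_le X (1 + X)⁻¹
  have h4 := mul_le_mul_of_nonneg_right hX (twoNorm_nonneg (1 + X)⁻¹)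
  have h5 := twoNorm_one_le (n := n)
  linarith

/-! ### The orthogonal projector onto the column space. -/

theorem pinv_mul_self {m n : ℕ} {A : Matrix (Fin m) (Fin n) ℝ} (hA : A.rank = n) :
    pinv A * A = 1 := by
  have h : pinv A = (A.transpose * A)⁻¹ * A.transpose :=
    (isMoorePenrose_pinv hA).unique (isMoorePenrose_of_rank_eq hA)
  have hu : IsUnit (A.transpose * A) := by
    have hsurj : Function.Surjective (A.transpose * A).mulVecLin := by
      rw [← LinearMap.range_eq_top]
      apply Submodule.eq_top_of_finrank_eq
      rw [Module.finrank_fin_fun]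
      exact (Matrix.rank_transpose_mul_self A).trans hA
    exact Matrix.mulVec_surjective_iff_isUnit.1 hsurj
  rw [h, Matrix.mul_assoc, Matrix.nonsing_inv_mul _ ((Matrix.isUnit_iff_isUnit_det _).1 hu)]

theorem IsOrthonormalRangeBasis.mul_pinv_mul {m n : ℕ} {A Q : Matrix (Fin m) (Fin n) ℝ}
    (hA : A.rank = n) (hQ : IsOrthonormalRangeBasis A Q) : A * pinv A * Q = Q := by
  refine Matrix.ext_of_mulVec_single fun i => ?_
  have hv : Q.mulVecLin (Pi.single i 1) ∈ LinearMap.range A.mulVecLin := by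
    rw [← hQ.range_eq]
    exact LinearMap.mem_range_self _ _
  obtain ⟨w, hw⟩ := hv
  rw [Matrix.mulVecLin_apply, Matrix.mulVecLin_apply] at hw
  rw [← Matrix.mulVec_mulVec, ← hw, Matrix.mulVec_mulVec, (isMoorePenrose_pinv hA).mul_mul_left]

theorem IsOrthonormalRangeBasis.mul_transpose_mul {m n : ℕ} {A Q : Matrix (Fin m) (Fin n) ℝ}
    (hQ : IsOrthonormalRangeBasis A Q) : Q * Q.transpose * A = A := by
  refine Matrix.ext_of_mulVec_single fun i => ?_
  have hv : A.mulVecLin (Pi.single i 1) ∈ LinearMap.range Q.mulVecLin := by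
    rw [hQ.range_eq]
    exact LinearMap.mem_range_self _ _
  obtain ⟨w, hw⟩ := hv
  rw [Matrix.mulVecLin_apply, Matrix.mulVecLin_apply] at hw
  rw [← Matrix.mulVec_mulVec, ← hw, Matrix.mulVec_mulVec, Matrix.mul_assoc, hQ.orthonormal,
    Matrix.mul_one]

/-- Two symmetric matrices, each fixing the other from the left, agree after a transpose. Leverage
scores are thus the diagonal of `AA†`, independent of `Q`. -/
theorem IsOrthonormalRangeBasis.mul_transpose_eq {m n : ℕ} {A Q : Matrix (Fin m) (Fin n) ℝ}
    (hA : A.rank = n) (hQ : IsOrthonormalRangeBasis A Q) : Q * Q.transpose = A * pinv A := by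
  have h1 : A * pinv A * (Q * Q.transpose) = Q * Q.transpose := by
    rw [← Matrix.mul_assoc, hQ.mul_pinv_mul hA]
  have h2 : Q * Q.transpose * (A * pinv A) = A * pinv A := by
    rw [← Matrix.mul_assoc, hQ.mul_transpose_mul]
  have h3 := congrArg Matrix.transpose h2
  rw [Matrix.transpose_mul, (isMoorePenrose_pinv hA).symm_left, Matrix.transpose_mul,
    Matrix.transpose_transpose, h1] at h3
  exact h3

/-- Follows from `A = Q(QᵀA)`. It trades a division by a row of `Q` for one by a row of `A`, at the
cost of the factor `‖A‖₂` in `κ₂`. -/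
theorem IsOrthonormalRangeBasis.rowNorm_le {m n : ℕ} {A Q : Matrix (Fin m) (Fin n) ℝ}
    (hQ : IsOrthonormalRangeBasis A Q) (j : Fin m) :
    rowNorm A j ≤ rowNorm Q j * twoNorm A := by
  have h1 := rowNorm_mul_le Q (Q.transpose * A) j
  rw [← Matrix.mul_assoc, hQ.mul_transpose_mul] at h1
  have h2 := twoNorm_mul_le Q.transpose A
  rw [twoNorm_transpose] at h2
  have h3 := mul_le_mul_of_nonneg_right (twoNorm_le_one_of_orthonormal hQ.orthonormal)
    (twoNorm_nonneg A)
  exact h1.trans (mul_le_mul_of_nonneg_left (by linarith) (rowNorm_nonneg Q j))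

theorem IsOrthonormalRangeBasis.rowNorm_pos {m n : ℕ} {A Q : Matrix (Fin m) (Fin n) ℝ}
    (hA : A.rank = n) (hQ : IsOrthonormalRangeBasis A Q) {j : Fin m} (hj : 0 < rowNorm Q j) :
    0 < rowNorm A j := by
  have h1 := rowNorm_mul_le A (pinv A * Q) j
  rw [← Matrix.mul_assoc, hQ.mul_pinv_mul hA] at h1
  refine (rowNorm_nonneg A j).lt_of_ne fun h => ?_
  rw [← h, zero_mul] at h1
  linarith

/-! ### Row norms under an orthogonal perturbation. -/

/-- If `Q` has orthonormal columns, `Qᵀ F = 0`, and `Q' T = Q + F` for a matrix `Q'` with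
orthonormal columns, then the squared row norms of `Q'` and `Q` are close. -/
theorem abs_rowNorm_sq_sub_le {m n : ℕ} {Q Q' F : Matrix (Fin m) (Fin n) ℝ}
    {T : Matrix (Fin n) (Fin n) ℝ} (hQ : Q.transpose * Q = 1) (hQ' : Q'.transpose * Q' = 1)
    (hF : Q.transpose * F = 0) (hT : Q' * T = Q + F) (j : Fin m) :
    |rowNorm Q' j ^ 2 - rowNorm Q j ^ 2| ≤
      2 * rowNorm Q j * rowNorm F j + rowNorm F j ^ 2 + twoNorm F ^ 2 * rowNorm Q j ^ 2 := by
  have hF' : F.transpose * Q = 0 := by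
    have := congrArg Matrix.transpose hF
    rwa [Matrix.transpose_mul, Matrix.transpose_transpose, Matrix.transpose_zero] at this
  have hG : T.transpose * T = 1 + F.transpose * F := by
    calc T.transpose * T = T.transpose * (Q'.transpose * Q') * T := by rw [hQ', Matrix.mul_one]
      _ = (Q' * T).transpose * (Q' * T) := by simp only [Matrix.transpose_mul, Matrix.mul_assoc]
      _ = 1 + F.transpose * F := by
        rw [hT, Matrix.transpose_add, Matrix.add_mul, Matrix.mul_add, Matrix.mul_add, hQ, hF, hF']
        simp
  have hTinj : Function.Injective T.mulVec := by
    intro v w hvw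
    rw [← sub_eq_zero]
    have h0 : T.mulVec (v - w) = 0 := by rw [Matrix.mulVec_sub]; exact sub_eq_zero.2 hvw
    have h1 : (Q + F).mulVec (v - w) = 0 := by
      rw [← hT, ← Matrix.mulVec_mulVec, h0, Matrix.mulVec_zero]
    have h2 := congrArg Q.transpose.mulVec h1
    rwa [Matrix.mulVec_mulVec, Matrix.mul_add, hQ, hF, add_zero, Matrix.one_mulVec,
      Matrix.mulVec_zero] at h2
  have hTd := (Matrix.isUnit_iff_isUnit_det _).1 (Matrix.mulVec_injective_iff_isUnit.1 hTinj)
  have hTS : T * T⁻¹ = 1 := Matrix.mul_nonsing_inv _ hTd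
  have hS : twoNorm T⁻¹ ≤ 1 := by
    refine twoNorm_le_one_of_add_eq_one (H := F * T⁻¹) ?_
    calc T⁻¹.transpose * T⁻¹ + (F * T⁻¹).transpose * (F * T⁻¹)
        = T⁻¹.transpose * (1 + F.transpose * F) * T⁻¹ := by
          simp only [Matrix.transpose_mul, Matrix.mul_add, Matrix.add_mul, Matrix.mul_assoc,
            Matrix.one_mul]
      _ = (T * T⁻¹).transpose * (T * T⁻¹) := by
          rw [← hG]; simp only [Matrix.transpose_mul, Matrix.mul_assoc]
      _ = 1 := by rw [hTS]; simp
  have hTn : twoNorm T ^ 2 ≤ 1 + twoNorm F ^ 2 := by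
    rw [← twoNorm_transpose_mul_self, hG, ← twoNorm_transpose_mul_self F]
    exact (twoNorm_add_le _ _).trans (by linarith [twoNorm_one_le (n := n)])
  have hQ'eq : Q' = Q * T⁻¹ + F * T⁻¹ := by
    rw [← Matrix.add_mul, ← hT, Matrix.mul_assoc, hTS, Matrix.mul_one]
  have hle : ∀ X : Matrix (Fin m) (Fin n) ℝ, rowNorm (X * T⁻¹) j ≤ rowNorm X j := fun X =>
    (rowNorm_mul_le X T⁻¹ j).trans (mul_le_of_le_one_right (rowNorm_nonneg X j) hS)
  have hq := hle Q
  have hf := hle F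
  have hup := rowNorm_add_le (Q * T⁻¹) (F * T⁻¹) j
  have hlo := rowNorm_le_add (Q * T⁻¹) (F * T⁻¹) j
  -- Undoing `T⁻¹` shows that the rows of `Q` shrink by at most the factor `‖T‖₂`.
  have hback := rowNorm_mul_le (Q * T⁻¹) T j
  rw [Matrix.mul_assoc, Matrix.nonsing_inv_mul _ hTd, Matrix.mul_one] at hback
  rw [← hQ'eq] at hup hlo
  have hq0 := rowNorm_nonneg (Q * T⁻¹) j
  have hf0 := rowNorm_nonneg (F * T⁻¹) j
  have hQ0 := rowNorm_nonneg Q j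
  have hF0 := rowNorm_nonneg F j
  have hl0 := rowNorm_nonneg Q' j
  have hφ := sq_nonneg (twoNorm F)
  generalize rowNorm (Q * T⁻¹) j = s at *
  generalize rowNorm (F * T⁻¹) j = g at *
  generalize rowNorm Q' j = l at *
  generalize rowNorm Q j = q at *
  generalize rowNorm F j = f at *
  have hsg : s * g ≤ q * f := mul_le_mul hq hf hf0 hQ0
  have hs2 : s ^ 2 ≤ q ^ 2 := pow_le_pow_left₀ hq0 hq 2
  have hback2 : q ^ 2 ≤ s ^ 2 * (1 + twoNorm F ^ 2) := by
    calc q ^ 2 ≤ (s * twoNorm T) ^ 2 := pow_le_pow_left₀ hQ0 hback 2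
      _ = s ^ 2 * twoNorm T ^ 2 := mul_pow _ _ _
      _ ≤ _ := mul_le_mul_of_nonneg_left hTn (sq_nonneg s)
  have hφs := mul_le_mul_of_nonneg_left hs2 hφ
  rw [abs_le]
  constructor
  · have : s ^ 2 - 2 * (s * g) ≤ l ^ 2 := by
      -- Squaring `s - g ≤ l` needs `s ≥ g`; otherwise the left side is nonpositive.
      rcases le_total s g with h | h
      · nlinarith [sq_nonneg l, mul_le_mul_of_nonneg_left h hq0, mul_nonneg hq0 hf0]
      · have := pow_le_pow_left₀ (sub_nonneg.2 h) (by linarith : s - g ≤ l) 2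
        nlinarith [sq_nonneg g]
    nlinarith [sq_nonneg f]
  · have h1 : l ^ 2 ≤ (q + f) ^ 2 := pow_le_pow_left₀ hl0 (by linarith) 2
    have h2 := mul_nonneg hφ (sq_nonneg q)
    nlinarith

/-! ### Perturbing `A`. -/

section Perturbation

variable {m n : ℕ} {A ΔA : Matrix (Fin m) (Fin n) ℝ}

theorem pinv_mul_add (hA : A.rank = n) : pinv A * (A + ΔA) = 1 + pinv A * ΔA := by
  rw [Matrix.mul_add, pinv_mul_self hA]

theorem twoNorm_pinv_mul_le (hΔ : twoNorm ΔA * twoNorm (pinv A) ≤ 1 / 2) :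
    twoNorm (pinv A * ΔA) ≤ 1 / 2 :=
  (twoNorm_mul_le _ _).trans (by rwa [mul_comm])

theorem isUnit_pinv_mul_add (hA : A.rank = n)
    (hΔ : twoNorm ΔA * twoNorm (pinv A) ≤ 1 / 2) : IsUnit (pinv A * (A + ΔA)) := by
  rw [pinv_mul_add hA]
  exact isUnit_one_add_of_twoNorm_lt_one (by linarith [twoNorm_pinv_mul_le hΔ])

theorem rank_add_eq (hA : A.rank = n) (hΔ : twoNorm ΔA * twoNorm (pinv A) ≤ 1 / 2) :
    (A + ΔA).rank = n := by
  refine le_antisymm (by simpa using (A + ΔA).rank_le_width) ?_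
  have h1 := Matrix.rank_mul_le_right (pinv A) (A + ΔA)
  rwa [Matrix.rank_of_isUnit _ (isUnit_pinv_mul_add hA hΔ), Fintype.card_fin] at h1

theorem IsThinQR.isOrthonormalRangeBasis {B Q' : Matrix (Fin m) (Fin n) ℝ}
    {R' : Matrix (Fin n) (Fin n) ℝ} (h : IsThinQR B Q' R') (hB : B.rank = n) :
    IsOrthonormalRangeBasis B Q' := by
  refine ⟨h.orthonormal, ?_⟩
  have hle : LinearMap.range B.mulVecLin ≤ LinearMap.range Q'.mulVecLin := by
    rw [h.eq_mul, Matrix.mulVecLin_mul]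
    exact LinearMap.range_comp_le_range _ _
  refine (Submodule.eq_of_le_of_finrank_le hle ?_).symm
  change Q'.rank ≤ B.rank
  rw [hB]
  simpa using Q'.rank_le_width

/-- Perturbation bound in terms of the norms of `(I - A A†) ΔA`. -/
theorem abs_leverage_sub_le (hA : A.rank = n)
    (hΔ : twoNorm ΔA * twoNorm (pinv A) ≤ 1 / 2) {Q Q' : Matrix (Fin m) (Fin n) ℝ}
    {R' : Matrix (Fin n) (Fin n) ℝ} (hQ : IsOrthonormalRangeBasis A Q)
    (hQR : IsThinQR (A + ΔA) Q' R') (j : Fin m) :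
    |rowNorm Q' j ^ 2 - rowNorm Q j ^ 2| ≤
      4 * rowNorm Q j * (rowNorm (projPert A ΔA) j * twoNorm (pinv A))
        + 4 * twoNorm (pinv A) ^ 2 * frobNorm (projPert A ΔA) ^ 2 * (1 + rowNorm Q j ^ 2) := by
  set M : Matrix (Fin n) (Fin n) ℝ := 1 + pinv A * ΔA with hM
  set E := projPert A ΔA with hE
  set W := M⁻¹ * (pinv A * Q) with hW
  have hMd : IsUnit M.det := (Matrix.isUnit_iff_isUnit_det _).1 (by
    rw [hM, ← pinv_mul_add hA]
    exact isUnit_pinv_mul_add hA hΔ)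
  have hB : A + ΔA = A * M + E := by
    rw [hM, hE, projPert, Matrix.mul_add, Matrix.sub_mul, Matrix.one_mul, Matrix.mul_one,
      Matrix.mul_assoc]
    abel
  have hBW : Q' * (R' * W) = Q + E * W := by
    rw [← Matrix.mul_assoc, ← hQR.eq_mul, hB, Matrix.add_mul, hW, Matrix.mul_assoc A,
      ← Matrix.mul_assoc M, Matrix.mul_nonsing_inv _ hMd, Matrix.one_mul, ← Matrix.mul_assoc A,
      hQ.mul_pinv_mul hA]
  have hQE : Q.transpose * (E * W) = 0 := by
    have h1 := congrArg Matrix.transpose (hQ.mul_pinv_mul hA)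
    rw [Matrix.transpose_mul, (isMoorePenrose_pinv hA).symm_left] at h1
    rw [hE, projPert, Matrix.mul_assoc, ← Matrix.mul_assoc, Matrix.mul_sub, h1, Matrix.mul_one,
      sub_self, Matrix.zero_mul]
  have hWn : twoNorm W ≤ 2 * twoNorm (pinv A) := by
    refine (twoNorm_mul_le _ _).trans ?_
    refine mul_le_mul (twoNorm_inv_one_add_le (twoNorm_pinv_mul_le hΔ)) ?_ (twoNorm_nonneg _)
      zero_le_two
    exact (twoNorm_mul_le _ _).trans (mul_le_of_le_one_right (twoNorm_nonneg _)
      (twoNorm_le_one_of_orthonormal hQ.orthonormal))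
  have hmain := abs_rowNorm_sq_sub_le hQ.orthonormal hQR.orthonormal hQE hBW j
  have hf : rowNorm (E * W) j ≤ rowNorm E j * (2 * twoNorm (pinv A)) :=
    (rowNorm_mul_le _ _ _).trans (mul_le_mul_of_nonneg_left hWn (rowNorm_nonneg _ _))
  -- The same row is bounded twice: sharply for the linear term, crudely for its square, which has
  -- to be a multiple of `(ε_F^⊥)²`.
  have hf2 : rowNorm (E * W) j ≤ frobNorm E * (2 * twoNorm (pinv A)) :=
    hf.trans (mul_le_mul_of_nonneg_right (rowNorm_le_frobNorm E j)
      (mul_nonneg zero_le_two (twoNorm_nonneg _)))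
  have hF : twoNorm (E * W) ≤ frobNorm E * (2 * twoNorm (pinv A)) :=
    (twoNorm_mul_le _ _).trans (mul_le_mul (twoNorm_le_frobNorm E) hWn (twoNorm_nonneg _)
      (frobNorm_nonneg E))
  have h1 := mul_le_mul_of_nonneg_left hf
    (mul_nonneg zero_le_two (rowNorm_nonneg Q j) : 0 ≤ 2 * rowNorm Q j)
  have h2 := pow_le_pow_left₀ (rowNorm_nonneg _ _) hf2 2
  have h3 := mul_le_mul_of_nonneg_right (pow_le_pow_left₀ (twoNorm_nonneg _) hF 2)
    (sq_nonneg (rowNorm Q j))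
  linarith

end Perturbation

end LeverageScores

open LeverageScores in
theorem mainTheorem7 {m n : ℕ} (A : Matrix (Fin m) (Fin n) ℝ) (hA : A.rank = n) :
    ∃ C : ℝ, ∀ ΔA : Matrix (Fin m) (Fin n) ℝ,
      twoNorm ΔA * twoNorm (pinv A) ≤ 1 / 2 →
      (A + ΔA).rank = n ∧
      ∀ (Q : Matrix (Fin m) (Fin n) ℝ), IsOrthonormalRangeBasis A Q →
      ∀ (Q' : Matrix (Fin m) (Fin n) ℝ) (R' : Matrix (Fin n) (Fin n) ℝ),
        IsThinQR (A + ΔA) Q' R' →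
        IsOrthonormalRangeBasis (A + ΔA) Q' ∧
        ∀ j : Fin m, 0 < rowNorm Q j ^ 2 →
          |rowNorm Q' j ^ 2 - rowNorm Q j ^ 2| / rowNorm Q j ^ 2 ≤
            4 * (epsPerpRow A ΔA j
                + Real.sqrt 2 * Real.sqrt (stableRank A) * epsPerpF A ΔA) * cond2 A
              + C * epsPerpF A ΔA ^ 2 := by
  -- The sum dominates every `1 / ℓ_j` with `ℓ_j > 0`, uniformly in `j`; rows with `ℓ_i = 0`
  -- contribute `0⁻¹ = 0`.
  refine ⟨4 * twoNorm (pinv A) ^ 2 * frobNorm A ^ 2 * (1 + ∑ i, |(A * pinv A) i i|⁻¹),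
    fun ΔA hΔ => ⟨rank_add_eq hA hΔ, fun Q hQ Q' R' hQR =>
      ⟨hQR.isOrthonormalRangeBasis (rank_add_eq hA hΔ), fun j hj => ?_⟩⟩⟩
  have hq : 0 < rowNorm Q j := (rowNorm_nonneg Q j).lt_of_ne fun h => by simp [← h] at hj
  have ha : 0 < rowNorm A j := hQ.rowNorm_pos hA hq
  have hFA : 0 < frobNorm A := ha.trans_le (rowNorm_le_frobNorm A j)
  have haq := hQ.rowNorm_le j
  have hsum : (rowNorm Q j ^ 2)⁻¹ ≤ ∑ i, |(A * pinv A) i i|⁻¹ := by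
    have h := Finset.single_le_sum (f := fun i => |(A * pinv A) i i|⁻¹)
      (fun i _ => inv_nonneg.2 (abs_nonneg _)) (Finset.mem_univ j)
    rwa [← hQ.mul_transpose_eq hA, ← rowNorm_sq, abs_of_pos hj, hQ.mul_transpose_eq hA] at h
  have hp := twoNorm_nonneg (pinv A)
  have he := rowNorm_nonneg (projPert A ΔA) j
  have hmain := div_le_div_of_nonneg_right (abs_leverage_sub_le hA hΔ hQ hQR j) hj.le
  refine hmain.trans ?_
  rw [add_div]
  refine add_le_add ?_ ?_
  · have h1 : 4 * rowNorm Q j * (rowNorm (projPert A ΔA) j * twoNorm (pinv A)) / rowNorm Q j ^ 2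
        ≤ 4 * epsPerpRow A ΔA j * cond2 A := by
      rw [epsPerpRow, cond2, div_le_iff₀ hj]
      calc 4 * rowNorm Q j * (rowNorm (projPert A ΔA) j * twoNorm (pinv A))
          = 4 * rowNorm Q j * (rowNorm (projPert A ΔA) j * twoNorm (pinv A)) / rowNorm A j
              * rowNorm A j := by field_simp
        _ ≤ 4 * rowNorm Q j * (rowNorm (projPert A ΔA) j * twoNorm (pinv A)) / rowNorm A j
              * (rowNorm Q j * twoNorm A) :=
            mul_le_mul_of_nonneg_left haq (by positivity)
        _ = _ := by ring
    have hκ : 0 ≤ cond2 A := mul_nonneg (twoNorm_nonneg _) (twoNorm_nonneg _)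
    have hε : 0 ≤ epsPerpF A ΔA := div_nonneg (frobNorm_nonneg _) (frobNorm_nonneg _)
    -- The `ε_j^⊥` term alone covers the linear part, so nonnegativity of the stable-rank term
    -- suffices.
    have h2 : 0 ≤ Real.sqrt 2 * Real.sqrt (stableRank A) * epsPerpF A ΔA * cond2 A := by
      positivity
    linarith
  · have hεF : frobNorm (projPert A ΔA) = epsPerpF A ΔA * frobNorm A := by
      rw [epsPerpF, div_mul_cancel₀ _ hFA.ne']
    calc 4 * twoNorm (pinv A) ^ 2 * frobNorm (projPert A ΔA) ^ 2 * (1 + rowNorm Q j ^ 2)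
          / rowNorm Q j ^ 2
        = 4 * twoNorm (pinv A) ^ 2 * frobNorm (projPert A ΔA) ^ 2
            * (1 + (rowNorm Q j ^ 2)⁻¹) := by field_simp; ring
      _ ≤ 4 * twoNorm (pinv A) ^ 2 * frobNorm (projPert A ΔA) ^ 2
            * (1 + ∑ i, |(A * pinv A) i i|⁻¹) :=
          mul_le_mul_of_nonneg_left (by linarith) (by positivity)
      _ = _ := by rw [hεF]; ring
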